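/- Let $T$ be a set of $10$ teams. A \emph{pairing list} with $8$ flights and races of $5$ teams is a list of $8$ flights, each of which is a partition of $T$ into races, every race being a set of exactly $5$ teams (so each flight consists of two races; flights and races may be repeated). For two teams $t \neq t'$ let $\lambda(t,t')$ be the number of races, counted with multiplicity over all flights, in which both $t$ and $t'$ take part, and put $\lambda_{\min} = \min_{t\neq t'} \lambda(t,t')$ and $\lambda_{\max} = \max_{t\neq t'} \lambda(t,t')$. A pairing list is \emph{optimal} if its utility value $\lambda_{\max}-\lambda_{\min}$ is minimal among all pairing lists with these parameters. A pairing list is described by a \emph{tournament plan}: the matrix with one row per flight and one column per team in which the entry at flight $f$ and team $t$ is the number ($1$ or $2$) of the race of $f$ in which $t$ takes part, where the two races of each flight are numbered by $1$ and $2$ in some order. \textbf{Theorem.} The minimum of $\lambda_{\max}-\lambda_{\min}$ over all pairing lists with $10$ teams, $8$ flights and races of $5$ teams is $3$, and every optimal pairing list satisfies $\lambda_{\min}=2$ and $\lambda_{\max}=5$. For every numbering of the teams by $1,\dots,10$ (the columns), the following matrix is the tournament plan of an optimal pairing list: $$\begin{pmatrix} 1&2&1&2&1&1&2&1&2&2\\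 1&1&2&2&1&2&1&1&2&2\\ 1&1&1&1&2&2&2&2&1&2\\ 1&1&2&1&1&2&2&2&2&1\\ 1&2&1&1&2&2&2&1&2&1\\ 1&2&2&1&2&1&1&1&2&2\\ 1&1&2&2&2&1&2&1&1&2\\ 1&1&2&2&2&1&1&2&2&1 \end{pmatrix}$$ -/

import Mathlib

/-- A pairing list on the finite set `T` of teams: a list of `nFlights` flights, each of which is a
partition of `T` into races, every race being a set of exactly `nInRace` teams. Flights, and hence
races, may be repeated; the list of all races consists of the pairs (flight index, race of it). -/
structure PairingList (T : Type*) [Fintype T] [DecidableEq T] (nFlights nInRace : ℕ) where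
  /-- The `i`-th flight. -/
  flight : Fin nFlights → Finpartition (Finset.univ : Finset T)
  card_race : ∀ i, ∀ r ∈ (flight i).parts, r.card = nInRace

namespace PairingList

/-- The number of pairings `λ(t, t')`: the number of races, counted with multiplicity over all
flights, in which both `t` and `t'` take part. -/
def pairings {T : Type*} [Fintype T] [DecidableEq T] {nFlights nInRace : ℕ}
    (P : PairingList T nFlights nInRace) (t t' : T) : ℕ :=
  ∑ i : Fin nFlights, ((P.flight i).parts.filter (fun r => t ∈ r ∧ t' ∈ r)).card

/-- The set of all values `λ(t, t')` for `t ≠ t'`. -/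
def pairingNumbers {T : Type*} [Fintype T] [DecidableEq T] {nFlights nInRace : ℕ}
    (P : PairingList T nFlights nInRace) : Set ℕ :=
  {m | ∃ t t' : T, t ≠ t' ∧ P.pairings t t' = m}

/-- `λ_min`, the minimum of `λ(t, t')` over `t ≠ t'` (attained if there are at least two teams). -/
noncomputable def lambdaMin {T : Type*} [Fintype T] [DecidableEq T] {nFlights nInRace : ℕ}
    (P : PairingList T nFlights nInRace) : ℕ :=
  sInf P.pairingNumbers

/-- `λ_max`, the maximum of `λ(t, t')` over `t ≠ t'` (attained if there are at least two teams). -/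
noncomputable def lambdaMax {T : Type*} [Fintype T] [DecidableEq T] {nFlights nInRace : ℕ}
    (P : PairingList T nFlights nInRace) : ℕ :=
  sSup P.pairingNumbers

theorem pairingNumbers_nonempty {T : Type*} [Fintype T] [DecidableEq T] [Nontrivial T]
    {nFlights nInRace : ℕ} (P : PairingList T nFlights nInRace) : P.pairingNumbers.Nonempty := by
  obtain ⟨t, t', h⟩ := exists_pair_ne T
  exact ⟨_, t, t', h, rfl⟩

theorem pairingNumbers_finite {T : Type*} [Fintype T] [DecidableEq T] {nFlights nInRace : ℕ}
    (P : PairingList T nFlights nInRace) : P.pairingNumbers.Finite := by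
  refine (Set.finite_range (fun p : T × T => P.pairings p.1 p.2)).subset ?_
  rintro m ⟨t, t', -, rfl⟩
  exact ⟨(t, t'), rfl⟩

theorem isLeast_lambdaMin {T : Type*} [Fintype T] [DecidableEq T] [Nontrivial T]
    {nFlights nInRace : ℕ} (P : PairingList T nFlights nInRace) :
    IsLeast P.pairingNumbers P.lambdaMin :=
  ⟨Nat.sInf_mem P.pairingNumbers_nonempty, fun _ h => Nat.sInf_le h⟩

theorem isGreatest_lambdaMax {T : Type*} [Fintype T] [DecidableEq T] [Nontrivial T]
    {nFlights nInRace : ℕ} (P : PairingList T nFlights nInRace) :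
    IsGreatest P.pairingNumbers P.lambdaMax :=
  ⟨Nat.sSup_mem P.pairingNumbers_nonempty P.pairingNumbers_finite.bddAbove,
    fun _ h => le_csSup P.pairingNumbers_finite.bddAbove h⟩

/-- The utility value `λ_max - λ_min`. -/
noncomputable def utility {T : Type*} [Fintype T] [DecidableEq T] {nFlights nInRace : ℕ}
    (P : PairingList T nFlights nInRace) : ℤ :=
  (P.lambdaMax : ℤ) - (P.lambdaMin : ℤ)

/-- A pairing list is optimal if its utility value is the smallest possible among all pairing lists
with the same parameters. -/
def IsOptimal {T : Type*} [Fintype T] [DecidableEq T] {nFlights nInRace : ℕ}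
    (P : PairingList T nFlights nInRace) : Prop :=
  ∀ Q : PairingList T nFlights nInRace, P.utility ≤ Q.utility

/-- The matrix `M`, with one row per flight and one column per team, is a tournament plan of the
pairing list `P`: in every flight the races can be numbered bijectively by `1, …, N`, where
`N = |T| / nInRace` is the number of races in a flight, such that the entry of `M` at a flight and a
team is the number of the race of that flight in which the team takes part. -/
def HasTournamentPlan {T : Type*} [Fintype T] [DecidableEq T] {nFlights nInRace : ℕ}
    (P : PairingList T nFlights nInRace) (M : Matrix (Fin nFlights) T ℕ) : Prop :=
  ∀ i : Fin nFlights, ∃ number : Finset T → ℕ,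
    Set.BijOn number (↑(P.flight i).parts : Set (Finset T))
      (Set.Icc 1 (Fintype.card T / nInRace)) ∧
    ∀ t : T, M i t = number ((P.flight i).part t)

end PairingList

/-- A tournament plan for ten teams (columns), eight flights (rows) and races of five teams. -/
def planTenTeamsEightFlights : Matrix (Fin 8) (Fin 10) ℕ :=
  !![1, 2, 1, 2, 1, 1, 2, 1, 2, 2;
     1, 1, 2, 2, 1, 2, 1, 1, 2, 2;
     1, 1, 1, 1, 2, 2, 2, 2, 1, 2;
     1, 1, 2, 1, 1, 2, 2, 2, 2, 1;
     1, 2, 1, 1, 2, 2, 2, 1, 2, 1;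
     1, 2, 2, 1, 2, 1, 1, 1, 2, 2;
     1, 1, 2, 2, 2, 1, 2, 1, 1, 2;
     1, 1, 2, 2, 2, 1, 1, 2, 2, 1]

/-! Record each flight as a row of signs, one per team; each row sums to zero. The inner product of
two columns is `2λ - 8`, so the rows of the Gram matrix sum to zero. Averaging gives `λ_min ≤ 3` and
`λ_max ≥ 4`; with utility at most 3, any pair other than `(2, 5)` has its off-diagonal inner
products all in `[-2, 4]` or all in `[-6, 0]`. Both are impossible, because ten columns of length
eight satisfy a relation `w ≠ 0` with `∑ w = 0`.

In `not_forall_gram_mem_Icc`, residues mod 4 split the columns into classes of sizes 6 and 4, zero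
row sums fix almost all of the Gram matrix, and the result admits only `w = 0`.

In `not_forall_gram_mem_Ioc`, the columns where `w` is maximal are orthogonal to the others, and
each part has zero row sums. The sizes must be 4 and 6. The four columns cut the rows into blocks of
sizes 4, 2, 2 on which the other six, after sign changes, are balanced; a finite search excludes
this.

The displayed plan attains 3. -/

/-! ### Gram matrices of sign columns -/

/-- Ten vectors of length eight satisfy a linear relation with coefficients of sum zero. -/
theorem exists_relation_sum_zero (v : Fin 8 → Fin 10 → ℤ) :
    ∃ w : Fin 10 → ℚ, w ≠ 0 ∧ ∑ i, w i = 0 ∧ ∀ t, ∑ i, w i * v t i = 0 := by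
  let f : (Fin 10 → ℚ) →ₗ[ℚ] (Fin 9 → ℚ) :=
    LinearMap.pi (Fin.cons (∑ i, LinearMap.proj i) fun t => ∑ i, (v t i : ℚ) • LinearMap.proj i)
  have hker : LinearMap.ker f ≠ ⊥ := LinearMap.ker_ne_bot_of_finrank_lt (by simp)
  obtain ⟨w, hw, hw0⟩ := (Submodule.ne_bot_iff _).1 hker
  have key : ∀ r, f w r = 0 := fun r => by rw [LinearMap.mem_ker.1 hw]; rfl
  refine ⟨w, hw0, ?_, fun t => ?_⟩
  · have := key 0
    simpa only [f, LinearMap.pi_apply, Fin.cons_zero, LinearMap.sum_apply, LinearMap.proj_apply]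
      using this
  · have := key t.succ
    simpa only [f, LinearMap.pi_apply, Fin.cons_succ, LinearMap.sum_apply, LinearMap.smul_apply,
      LinearMap.proj_apply, smul_eq_mul, mul_comm] using this

/-- The inner product of two columns. -/
def gram {ι : Type*} (v : Fin 8 → ι → ℤ) (i j : ι) : ℤ := ∑ t, v t i * v t j

theorem gram_comm {ι : Type*} (v : Fin 8 → ι → ℤ) (i j : ι) : gram v i j = gram v j i := by
  simp only [gram, mul_comm]

theorem gram_self {ι : Type*} {v : Fin 8 → ι → ℤ} (hv : ∀ t i, v t i = 1 ∨ v t i = -1) (i : ι) :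
    gram v i i = 8 := by
  have : ∀ t, v t i * v t i = 1 := fun t => by rcases hv t i with h | h <;> simp [h]
  simp [gram, this]

theorem sum_gram {ι : Type*} {v : Fin 8 → ι → ℤ} {s : Finset ι} (hs : ∀ t, ∑ i ∈ s, v t i = 0)
    (i : ι) : ∑ j ∈ s, gram v i j = 0 := by
  simp only [gram]
  rw [Finset.sum_comm]
  simp [← Finset.mul_sum, hs]

theorem sum_gram_mul_relation {v : Fin 8 → Fin 10 → ℤ} {w : Fin 10 → ℚ}
    (hw : ∀ t, ∑ i, w i * v t i = 0) (i : Fin 10) : ∑ j, (gram v i j : ℚ) * w j = 0 := by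
  have : ∀ j, (gram v i j : ℚ) * w j = ∑ t, (v t i : ℚ) * (w j * v t j) := fun j => by
    rw [gram]; push_cast; rw [Finset.sum_mul]
    exact Finset.sum_congr rfl fun t _ => by ring
  simp only [this]
  rw [Finset.sum_comm]
  simp [← Finset.mul_sum, hw]

/-- For signs, `ab + bc + ac` is 3 or -1, so it is 3 mod 4 in each row; the eight rows contribute
`24` mod 4. -/
theorem four_dvd_gram_triangle {ι : Type*} {v : Fin 8 → ι → ℤ}
    (hv : ∀ t i, v t i = 1 ∨ v t i = -1) (i j k : ι) :
    (4 : ℤ) ∣ gram v i j + gram v j k + gram v i k := by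
  have h : gram v i j + gram v j k + gram v i k
      = ∑ t, (v t i * v t j + v t j * v t k + v t i * v t k - 3) + 24 := by
    simp [gram, Finset.sum_add_distrib, Finset.sum_sub_distrib]
  rw [h]
  refine dvd_add (Finset.dvd_sum fun t _ => ?_) (by norm_num)
  rcases hv t i with h1 | h1 <;> rcases hv t j with h2 | h2 <;> rcases hv t k with h3 | h3 <;>
    simp [h1, h2, h3]

theorem two_dvd_gram {ι : Type*} {v : Fin 8 → ι → ℤ}
    (hv : ∀ t i, v t i = 1 ∨ v t i = -1) (i j : ι) : (2 : ℤ) ∣ gram v i j := by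
  have h := four_dvd_gram_triangle hv i i j
  rw [gram_self hv] at h
  omega

/-! ### Inner products between -2 and 4 -/

/-- The columns of a matrix with entries `±1` and zero row sums fall into two classes according to
their inner products modulo 4; if these are at least `-2`, one of the classes has six elements. -/
theorem exists_class_of_card_six {v : Fin 8 → Fin 10 → ℤ} (hv : ∀ t i, v t i = 1 ∨ v t i = -1)
    (hs : ∀ t, ∑ i, v t i = 0) (h1 : ∀ i j, i ≠ j → -2 ≤ gram v i j) :
    ∃ X : Finset (Fin 10), X.card = 6 ∧ ∀ i j, (4 : ℤ) ∣ gram v i j ↔ (i ∈ X ↔ j ∈ X) := by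
  have key : ∀ i, ∀ X : Finset (Fin 10), (∀ j, j ∈ X ↔ (4 : ℤ) ∣ gram v i j) →
      X.card ≤ 6 ∧ Even X.card := by
    intro i X hX
    have hsum := sum_gram (s := Finset.univ) hs i
    have hc : Xᶜ.card = 10 - X.card := by simp [Finset.card_compl]
    have hle : X.card ≤ 10 := by simpa using Finset.card_le_univ X
    have hiX : i ∈ X := (hX i).2 (by rw [gram_self hv]; norm_num)
    rw [← Finset.sum_add_sum_compl X] at hsum
    -- In row `i`, the class contributes at least the diagonal 8 and each other column at least -2,
    -- so at least four columns lie outside. Evenness follows from the row sum mod 4, outside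
    -- entries being 2 mod 4.
    constructor
    · have ha : (8 : ℤ) ≤ ∑ j ∈ X, gram v i j := by
        rw [← Finset.add_sum_erase X _ hiX, gram_self hv]
        have : 0 ≤ ∑ j ∈ X.erase i, gram v i j := Finset.sum_nonneg fun j hj => by
          have hj' := Finset.mem_erase.1 hj
          have := (hX j).1 hj'.2
          have := h1 i j hj'.1.symm
          omega
        linarith
      have hb : Xᶜ.card • (-2 : ℤ) ≤ ∑ j ∈ Xᶜ, gram v i j :=
        Finset.card_nsmul_le_sum _ _ _ fun j hj => h1 i j (by
          rintro rfl; exact Finset.mem_compl.1 hj hiX)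
      rw [hc, nsmul_eq_mul] at hb
      push_cast [hle] at hb
      omega
    · have ha : (4 : ℤ) ∣ ∑ j ∈ X, gram v i j := Finset.dvd_sum fun j hj => (hX j).1 hj
      have hb : (4 : ℤ) ∣ ∑ j ∈ Xᶜ, (gram v i j - 2) := Finset.dvd_sum fun j hj => by
        have := two_dvd_gram hv i j
        have : ¬(4 : ℤ) ∣ gram v i j := fun h => Finset.mem_compl.1 hj ((hX j).2 h)
        omega
      rw [Finset.sum_sub_distrib, Finset.sum_const, hc, nsmul_eq_mul] at hb
      push_cast [hle] at hb
      rw [Nat.even_iff]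
      omega
  let K : Finset (Fin 10) := Finset.univ.filter fun j => (4 : ℤ) ∣ gram v 0 j
  have hK : ∀ j, j ∈ K ↔ (4 : ℤ) ∣ gram v 0 j := fun j => by simp [K]
  have hiff : ∀ i j, (4 : ℤ) ∣ gram v i j ↔ (i ∈ K ↔ j ∈ K) := fun i j => by
    rw [hK, hK]
    have := four_dvd_gram_triangle hv 0 i j
    have := two_dvd_gram hv 0 i
    have := two_dvd_gram hv 0 j
    have := two_dvd_gram hv i j
    omega
  obtain ⟨hK6, hKe⟩ := key 0 K hK
  have hc : Kᶜ.card = 10 - K.card := by simp [Finset.card_compl]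
  obtain ⟨y, hy⟩ : Kᶜ.Nonempty := by rw [← Finset.card_pos]; omega
  have hy' := Finset.mem_compl.1 hy
  obtain ⟨hL6, -⟩ := key y Kᶜ fun j => by rw [hiff, Finset.mem_compl]; tauto
  have h46 : K.card = 6 ∨ K.card = 4 := by
    rw [Nat.even_iff] at hKe; omega
  rcases h46 with h | h
  · exact ⟨K, h, hiff⟩
  · refine ⟨Kᶜ, by omega, fun i j => ?_⟩
    rw [hiff, Finset.mem_compl, Finset.mem_compl]; tauto

/-- Ten columns of length eight with entries `±1` and zero row sums cannot have all their mutual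
inner products between `-2` and `4`. -/
theorem not_forall_gram_mem_Icc {v : Fin 8 → Fin 10 → ℤ} (hv : ∀ t i, v t i = 1 ∨ v t i = -1)
    (hs : ∀ t, ∑ i, v t i = 0) (h1 : ∀ i j, i ≠ j → -2 ≤ gram v i j)
    (h2 : ∀ i j, i ≠ j → gram v i j ≤ 4) : False := by
  obtain ⟨X, hX, hiff⟩ := exists_class_of_card_six hv hs h1
  have hXc : Xᶜ.card = 4 := by simp [Finset.card_compl, hX]
  -- With six columns inside and four outside, the bound `8 - 2 * 4 = 0` on the row sum is attained,
  -- so every entry is extremal.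
  have hge : ∀ i ∈ X, (∀ j ∈ X.erase i, gram v i j = 0) ∧ ∀ j ∈ Xᶜ, gram v i j = -2 := by
    intro i hi
    have hsum := sum_gram (s := Finset.univ) hs i
    rw [← Finset.sum_add_sum_compl X, ← Finset.add_sum_erase X _ hi, gram_self hv] at hsum
    have n1 : ∀ j ∈ X.erase i, 0 ≤ gram v i j := fun j hj => by
      have hj' := Finset.mem_erase.1 hj
      have := (hiff i j).2 (by tauto)
      have := h1 i j hj'.1.symm
      omega
    have n2 : ∀ j ∈ Xᶜ, 0 ≤ gram v i j + 2 := fun j hj => by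
      have := h1 i j (by rintro rfl; exact Finset.mem_compl.1 hj hi)
      omega
    have s2 : ∑ j ∈ Xᶜ, (gram v i j + 2) = ∑ j ∈ Xᶜ, gram v i j + 8 := by
      rw [Finset.sum_add_distrib, Finset.sum_const, hXc]; norm_num
    have p1 := Finset.sum_nonneg n1
    have p2 := Finset.sum_nonneg n2
    have z1 := (Finset.sum_eq_zero_iff_of_nonneg n1).1 (by linarith)
    have z2 := (Finset.sum_eq_zero_iff_of_nonneg n2).1 (by linarith)
    exact ⟨z1, fun j hj => by linarith [z2 j hj]⟩
  obtain ⟨w, hw0, hws, hw⟩ := exists_relation_sum_zero v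
  have hG := sum_gram_mul_relation hw
  have hwX : ∀ i ∈ X, 8 * w i = 2 * ∑ j ∈ Xᶜ, w j := by
    intro i hi
    have h := hG i
    rw [← Finset.sum_add_sum_compl X, ← Finset.add_sum_erase X _ hi, gram_self hv,
      Finset.sum_eq_zero (s := X.erase i) (fun j hj => by rw [(hge i hi).1 j hj]; simp),
      Finset.sum_congr (s₁ := Xᶜ) rfl
        (fun j hj => show _ = (-2 : ℚ) * w j by rw [(hge i hi).2 j hj]; norm_num),
      ← Finset.mul_sum] at h
    push_cast at h
    linarith
  -- Summing `hwX` gives `8 ∑_X w = 12 ∑_Xᶜ w`, while the two sums are opposite.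
  have hY0 : ∑ j ∈ Xᶜ, w j = 0 := by
    have h := Finset.sum_congr rfl hwX
    rw [← Finset.mul_sum, Finset.sum_const, hX, nsmul_eq_mul] at h
    have h' := hws
    rw [← Finset.sum_add_sum_compl X] at h'
    push_cast at h
    linarith
  have hX0 : ∀ i ∈ X, w i = 0 := fun i hi => by have := hwX i hi; rw [hY0] at this; linarith
  -- The rest of row `y` inside `Xᶜ` sums to `12 - 8 = 4` with entries 0 or 4, so exactly one entry
  -- is 4.
  have hpartner : ∀ y ∈ Xᶜ, ∃ z ∈ Xᶜ, 2 * w y + w z = 0 := by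
    intro y hy
    have hyX := Finset.mem_compl.1 hy
    have hsum := sum_gram (s := Finset.univ) hs y
    rw [← Finset.sum_add_sum_compl X, Finset.sum_congr (s₁ := X) rfl
        (fun j hj => show gram v y j = -2 by rw [gram_comm]; exact (hge j hj).2 y hy),
      Finset.sum_const, hX, ← Finset.add_sum_erase Xᶜ _ hy, gram_self hv] at hsum
    have hval : ∀ j ∈ Xᶜ.erase y, gram v y j = 0 ∨ gram v y j = 4 := fun j hj => by
      have hj' := Finset.mem_erase.1 hj
      have hjX := Finset.mem_compl.1 hj'.2
      have := (hiff y j).2 (by tauto)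
      have := h1 y j hj'.1.symm
      have := h2 y j hj'.1.symm
      omega
    have hsum4 : ∑ j ∈ Xᶜ.erase y, gram v y j = 4 := by
      rw [nsmul_eq_mul] at hsum; push_cast at hsum; linarith
    obtain ⟨z, hz, hz4⟩ : ∃ z ∈ Xᶜ.erase y, gram v y z ≠ 0 := by
      apply Finset.exists_ne_zero_of_sum_ne_zero; rw [hsum4]; norm_num
    have hz4 : gram v y z = 4 := (hval z hz).resolve_left hz4
    have hrest : ∀ j ∈ (Xᶜ.erase y).erase z, gram v y j = 0 := by
      rw [← Finset.add_sum_erase _ _ hz, hz4] at hsum4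
      refine (Finset.sum_eq_zero_iff_of_nonneg fun j hj => ?_).1 (by linarith)
      rcases hval j (Finset.mem_of_mem_erase hj) with h | h <;> rw [h]
      norm_num
    refine ⟨z, Finset.mem_of_mem_erase hz, ?_⟩
    have h := hG y
    rw [← Finset.sum_add_sum_compl X,
      Finset.sum_eq_zero (s := X) (fun j hj => by rw [hX0 j hj, mul_zero]),
      ← Finset.add_sum_erase Xᶜ _ hy, ← Finset.add_sum_erase _ _ hz, gram_self hv, hz4,
      Finset.sum_eq_zero (s := (Xᶜ.erase y).erase z)
        (fun j hj => by rw [hrest j hj]; simp)] at h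
    push_cast at h
    linarith
  apply hw0
  -- A partner has twice the absolute value, so the largest one is zero.
  obtain ⟨m, hm, hmax⟩ := Finset.exists_max_image Xᶜ (fun i => |w i|)
    (Finset.card_pos.1 (by omega))
  have hm0 : w m = 0 := by
    obtain ⟨z, hz, hmz⟩ := hpartner m hm
    have h1 := hmax z hz
    have h2 : w z = -(2 * w m) := by linarith
    simp only [h2, abs_neg, abs_mul, abs_two] at h1
    exact abs_eq_zero.1 (by linarith [abs_nonneg (w m)])
  funext i
  by_cases hi : i ∈ X
  · exact hX0 i hi
  · have := hmax i (Finset.mem_compl.2 hi)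
    simp only [hm0, abs_zero] at this
    exact abs_eq_zero.1 (le_antisymm this (abs_nonneg _))

/-! ### Block vectors and the finite search -/

/-- A vector of length eight with entries `±1` which sums to zero on `{0, 1, 2, 3}`, on `{4, 5}` and
on `{6, 7}` is given by one of three balanced patterns on the first block and three signs. -/
abbrev BlockVector : Type := Fin 3 × Bool × Bool × Bool

namespace BlockVector

/-- The sign of a truth value. -/
def sign (b : Bool) : ℤ := if b then 1 else -1

/-- The three balanced patterns of length four, up to sign. -/
def pattern : Fin 3 → Fin 4 → ℤ := ![![1, 1, -1, -1], ![1, -1, 1, -1], ![1, -1, -1, 1]]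

/-- The entries of a block vector. -/
def entry (p : BlockVector) : Fin 8 → ℤ :=
  ![sign p.2.1 * pattern p.1 0, sign p.2.1 * pattern p.1 1, sign p.2.1 * pattern p.1 2,
    sign p.2.1 * pattern p.1 3, sign p.2.2.1, -sign p.2.2.1, sign p.2.2.2, -sign p.2.2.2]

/-- The inner product of two block vectors. -/
def inner (p q : BlockVector) : ℤ :=
  (if p.1 = q.1 then 4 * (sign p.2.1 * sign q.2.1) else 0) +
    2 * (sign p.2.2.1 * sign q.2.2.1) + 2 * (sign p.2.2.2 * sign q.2.2.2)

/-- Distinct balanced patterns of length four are orthogonal, so the first block contributes 0 or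
±4. -/
theorem inner_eq_sum (p q : BlockVector) : p.inner q = ∑ t, p.entry t * q.entry t := by
  revert p q
  decide +kernel

theorem exists_entry_eq {z : Fin 8 → ℤ} (hz : ∀ t, z t = 1 ∨ z t = -1)
    (hA : z 0 + z 1 + z 2 + z 3 = 0) (hB : z 4 + z 5 = 0) (hC : z 6 + z 7 = 0) :
    ∃ p : BlockVector, ∀ t, z t = p.entry t := by
  have hsign : ∀ t, ∃ b, z t = sign b := fun t =>
    (hz t).elim (fun h => ⟨true, h⟩) (fun h => ⟨false, h⟩)
  obtain ⟨e, he⟩ := hsign 0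
  obtain ⟨b, hb⟩ := hsign 4
  obtain ⟨c, hc⟩ := hsign 6
  have h5 : z 5 = -sign b := by omega
  have h7 : z 7 = -sign c := by omega
  have hk : ∃ k, z 1 = sign e * pattern k 1 ∧ z 2 = sign e * pattern k 2 ∧
      z 3 = sign e * pattern k 3 := by
    obtain ⟨e1, h1⟩ := hsign 1
    obtain ⟨e2, h2⟩ := hsign 2
    obtain ⟨e3, h3⟩ := hsign 3
    rw [he, h1, h2, h3] at hA
    rw [h1, h2, h3]
    clear * - hA
    revert e e1 e2 e3
    decide
  obtain ⟨k, h1, h2, h3⟩ := hk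
  have hk0 : ∀ k, pattern k 0 = 1 := by decide
  have h0 : z 0 = sign e * pattern k 0 := by rw [he, hk0, mul_one]
  refine ⟨(k, e, b, c), fun t => ?_⟩
  fin_cases t <;> simp [entry, *]

/-- All block vectors. -/
def all : List BlockVector :=
  (List.finRange 3).flatMap fun k => [true, false].flatMap fun e => [true, false].flatMap fun b =>
    [true, false].map fun c => (k, e, b, c)

theorem mem_all (p : BlockVector) : p ∈ all := by
  revert p
  decide

/-- The inner product is nonpositive and greater than `-8`. -/
def compatible (p q : BlockVector) : Bool :=
  decide (p.inner q ≤ 0) && decide (-8 < p.inner q)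

theorem compatible_iff {p q : BlockVector} :
    compatible p q = true ↔ p.inner q ≤ 0 ∧ -8 < p.inner q := by
  simp [compatible]

/-- No `n` mutually compatible members of the list `l` have, together with `s`, the sum zero. -/
def noZeroSum : ℕ → List BlockVector → List BlockVector → Bool
  | 0, s, _ => decide (∃ t, (s.map fun p => p.entry t).sum ≠ 0)
  | n + 1, s, l => l.tails.all fun l' => match l' with
    | [] => true
    | p :: l'' => noZeroSum n (p :: s) (l''.filter (compatible p))

theorem noZeroSum_six : noZeroSum 6 [] all = true := by
  decide +kernel

/-- Soundness of the backtracking search: the head of `L` starts some tail of `l`, and the rest of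
`L` survives the filter by compatibility with that head. -/
theorem exists_sum_ne_zero_of_noZeroSum {n : ℕ} {s l L : List BlockVector}
    (h : noZeroSum n s l = true) (hL : L.Sublist l) (hn : L.length = n)
    (hc : L.Pairwise fun p q => compatible p q = true) :
    ∃ t, ((L ++ s).map fun p => p.entry t).sum ≠ 0 := by
  induction n generalizing s l L with
  | zero =>
    obtain rfl := List.length_eq_zero_iff.1 hn
    simpa [noZeroSum] using h
  | succ n ih =>
    obtain ⟨p, L, rfl⟩ := List.exists_cons_of_length_eq_add_one hn
    obtain ⟨r₁, r₂, rfl, hp, hsub⟩ := List.cons_sublist_iff.1 hL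
    obtain ⟨u, u', rfl⟩ := List.append_of_mem hp
    rw [List.pairwise_cons] at hc
    rw [noZeroSum, List.all_eq_true] at h
    have h' := h (p :: (u' ++ r₂)) ((List.mem_tails _ _).2 ⟨u, by simp⟩)
    have hsub' : L.Sublist ((u' ++ r₂).filter (compatible p)) := by
      have := (hsub.trans (List.sublist_append_right u' r₂)).filter (compatible p)
      rwa [List.filter_eq_self.2 hc.1] at this
    obtain ⟨t, ht⟩ := ih h' hsub' (by simpa using hn) hc.2
    refine ⟨t, ?_⟩
    simp only [List.map_append, List.map_cons, List.sum_append, List.sum_cons] at ht ⊢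
    intro h0
    apply ht
    rw [← h0]
    ring

/-- Six block vectors whose inner products are nonpositive and greater than `-8` do not have the
sum zero. -/
theorem exists_sum_ne_zero (p : Fin 6 → BlockVector)
    (h : ∀ i j, i ≠ j → (p i).inner (p j) ≤ 0 ∧ -8 < (p i).inner (p j)) :
    ∃ t, ∑ i, (p i).entry t ≠ 0 := by
  -- Equal vectors would have inner product 8, so the six are distinct and form a sublist of `all`.
  have hself : ∀ q : BlockVector, q.inner q = 8 := by decide
  have hinj : Function.Injective p := fun i j hij => by
    by_contra hne
    have := (h i j hne).1
    rw [hij, hself] at this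
    norm_num at this
  have hall : all.Nodup := by decide
  let L := all.filter fun q => decide (q ∈ Finset.univ.image p)
  have hmem : ∀ q, q ∈ L ↔ q ∈ Finset.univ.image p := fun q => by
    simp [L, mem_all]
  have hnd : L.Nodup := hall.filter _
  have hLF : L.toFinset = Finset.univ.image p := by
    ext q
    rw [List.mem_toFinset, hmem]
  have hlen : L.length = 6 := by
    rw [← List.toFinset_card_of_nodup hnd, hLF, Finset.card_image_of_injective _ hinj]
    simp
  have hpw : L.Pairwise fun p q => compatible p q = true := by
    refine List.Pairwise.imp_of_mem (fun {a b} ha hb hab => ?_) hnd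
    rw [hmem, Finset.mem_image] at ha hb
    obtain ⟨i, -, rfl⟩ := ha
    obtain ⟨j, -, rfl⟩ := hb
    exact compatible_iff.2 (h i j fun hij => hab (by rw [hij]))
  obtain ⟨t, ht⟩ := exists_sum_ne_zero_of_noZeroSum noZeroSum_six List.filter_sublist hlen hpw
  refine ⟨t, ?_⟩
  rwa [List.append_nil, ← List.sum_toFinset _ hnd, hLF,
    Finset.sum_image fun i _ j _ hij => hinj hij] at ht

end BlockVector

/-- Six vectors with entries `±1` and sum zero which are balanced on three blocks of lengths four,
two and two have an inner product which is positive or equal to `-8`. -/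
theorem not_forall_gram_of_blocks {z : Fin 8 → Fin 6 → ℤ} (hz : ∀ t i, z t i = 1 ∨ z t i = -1)
    (hsum : ∀ t, ∑ i, z t i = 0) (hA : ∀ i, z 0 i + z 1 i + z 2 i + z 3 i = 0)
    (hB : ∀ i, z 4 i + z 5 i = 0) (hC : ∀ i, z 6 i + z 7 i = 0)
    (hg : ∀ i j, i ≠ j → gram z i j ≤ 0 ∧ -8 < gram z i j) : False := by
  choose p hp using fun i =>
    BlockVector.exists_entry_eq (fun t => hz t i) (hA i) (hB i) (hC i)
  obtain ⟨t, ht⟩ := BlockVector.exists_sum_ne_zero p fun i j hij => by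
    rw [BlockVector.inner_eq_sum]
    simpa only [gram, ← hp] using hg i j hij
  apply ht
  simpa only [← hp] using hsum t

/-! ### Reduction of four plus six columns to blocks -/

/-- The blocks of the standard partition of eight rows into parts of sizes four, two and two. -/
def standardBlock : Fin 8 → Fin 3 := ![0, 0, 0, 0, 1, 1, 2, 2]

/-- The swap moves the block of size four to the front; fibres of equal size are then matched. -/
theorem exists_equiv_standardBlock {κ : Fin 8 → Fin 3} {k₀ : Fin 3}
    (h : ∀ k, (Finset.univ.filter fun t => κ t = k).card = if k = k₀ then 4 else 2) :
    ∃ (σ : Fin 8 ≃ Fin 8) (τ : Fin 3 ≃ Fin 3), ∀ t, κ (σ t) = τ (standardBlock t) := by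
  have hstd : ∀ k, (Finset.univ.filter fun t => Equiv.swap 0 k₀ (standardBlock t) = k).card =
      if k = k₀ then 4 else 2 := by
    clear h
    revert k₀
    decide
  let e : ∀ k, {t // Equiv.swap 0 k₀ (standardBlock t) = k} ≃ {t // κ t = k} := fun k =>
    Fintype.equivOfCardEq (by rw [Fintype.card_subtype, Fintype.card_subtype, h, hstd])
  exact ⟨Equiv.ofFiberEquiv e, Equiv.swap 0 k₀, fun t => Equiv.ofFiberEquiv_map e t⟩

theorem sum_filter_standardBlock (f : Fin 8 → ℤ) :
    (∑ t with standardBlock t = 0, f t = f 0 + f 1 + f 2 + f 3) ∧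
    (∑ t with standardBlock t = 1, f t = f 4 + f 5) ∧
    ∑ t with standardBlock t = 2, f t = f 6 + f 7 := by
  have h0 : (Finset.univ.filter fun t => standardBlock t = 0) = {0, 1, 2, 3} := by decide
  have h1 : (Finset.univ.filter fun t => standardBlock t = 1) = {4, 5} := by decide
  have h2 : (Finset.univ.filter fun t => standardBlock t = 2) = {6, 7} := by decide
  rw [h0, h1, h2]
  refine ⟨?_, ?_, ?_⟩ <;> simp [add_assoc]

theorem exists_eq_four_of_sum_eq_eight {n : Fin 3 → ℕ} (hsum : ∑ k, n k = 8)
    (heven : ∀ k, Even (n k)) (h : ∀ k, 0 < n k ∧ n k ≤ 4) :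
    ∃ k₀, ∀ k, n k = if k = k₀ then 4 else 2 := by
  simp only [Nat.even_iff] at heven
  rw [Fin.sum_univ_three] at hsum
  have e0 := heven 0
  have e1 := heven 1
  have e2 := heven 2
  have b0 := h 0
  have b1 := h 1
  have b2 := h 2
  have : n 0 = 4 ∧ n 1 = 2 ∧ n 2 = 2 ∨ n 0 = 2 ∧ n 1 = 4 ∧ n 2 = 2 ∨
      n 0 = 2 ∧ n 1 = 2 ∧ n 2 = 4 := by omega
  rcases this with ⟨h0, h1, h2⟩ | ⟨h0, h1, h2⟩ | ⟨h0, h1, h2⟩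
  · exact ⟨0, fun k => by fin_cases k <;> simp [h0, h1, h2]⟩
  · exact ⟨1, fun k => by fin_cases k <;> simp [h0, h1, h2]⟩
  · exact ⟨2, fun k => by fin_cases k <;> simp [h0, h1, h2]⟩

theorem even_card_of_sum_eq_zero {ι : Type*} {s : Finset ι} {f : ι → ℤ}
    (hf : ∀ i, f i = 1 ∨ f i = -1) (h : ∑ i ∈ s, f i = 0) : Even s.card := by
  have h2 : (2 : ℤ) ∣ ∑ i ∈ s, (f i - 1) := Finset.dvd_sum fun i _ => by
    rcases hf i with h | h <;> rw [h] <;> norm_num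
  rw [Finset.sum_sub_distrib, h, Finset.sum_const, nsmul_eq_mul] at h2
  rw [Nat.even_iff]
  omega

/-- Four and six columns of length eight, with entries `±1`, each of the two systems with sum zero
and the two systems orthogonal to each other, have two columns in the same system whose inner
product is positive or equal to `-8`. -/
theorem not_forall_gram_of_four_six {x : Fin 8 → Fin 4 → ℤ} {y : Fin 8 → Fin 6 → ℤ}
    (hx : ∀ t i, x t i = 1 ∨ x t i = -1) (hy : ∀ t i, y t i = 1 ∨ y t i = -1)
    (hxs : ∀ t, ∑ i, x t i = 0) (hys : ∀ t, ∑ i, y t i = 0)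
    (hxy : ∀ i j, ∑ t, x t i * y t j = 0)
    (hgx : ∀ i j, i ≠ j → gram x i j ≤ 0 ∧ -8 < gram x i j)
    (hgy : ∀ i j, i ≠ j → gram y i j ≤ 0 ∧ -8 < gram y i j) : False := by
  -- Each row of `x` has two signs of each kind, so exactly one later column agrees with column 0.
  have hκ : ∀ t, ∃ k : Fin 3, ∀ l : Fin 3, x t l.succ = if k = l then x t 0 else -x t 0 := by
    intro t
    have hs := hxs t
    rw [Fin.sum_univ_four] at hs
    rcases hx t 0 with h0 | h0 <;> rcases hx t 1 with h1 | h1 <;> rcases hx t 2 with h2 | h2 <;>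
      rcases hx t 3 with h3 | h3 <;> rw [h0, h1, h2, h3] at hs <;> first
      | (exfalso; omega)
      | (refine ⟨0, fun l => ?_⟩; fin_cases l <;> simp [h0, h1, h2, h3]; done)
      | (refine ⟨1, fun l => ?_⟩; fin_cases l <;> simp [h0, h1, h2, h3]; done)
      | (refine ⟨2, fun l => ?_⟩; fin_cases l <;> simp [h0, h1, h2, h3])
  choose κ hκ using hκ
  have hcard : ∀ k, gram x 0 k.succ = 2 * (Finset.univ.filter fun t => κ t = k).card - 8 := by
    intro k
    have : ∀ t, x t 0 * x t k.succ = 2 * (if κ t = k then 1 else 0) - 1 := fun t => by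
      rw [hκ t k]
      rcases hx t 0 with h | h <;> split_ifs <;> simp [h]
    simp only [gram, this, Finset.sum_sub_distrib, ← Finset.mul_sum, Finset.sum_boole]
    simp
  have hsumcard : ∑ k, (Finset.univ.filter fun t => κ t = k).card = 8 := by
    rw [← Finset.card_eq_sum_card_fiberwise (f := κ) (s := Finset.univ) (by simp)]
    simp
  -- The sum of columns 0 and `k.succ` of `x` is twice column 0 on block `k` and zero elsewhere, and
  -- it is orthogonal to `y`.
  have hblock : ∀ k i, ∑ t with κ t = k, x t 0 * y t i = 0 := by
    intro k i
    have h : ∑ t, (x t 0 * y t i + x t k.succ * y t i) = 0 := by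
      rw [Finset.sum_add_distrib, hxy, hxy, add_zero]
    have : ∀ t, x t 0 * y t i + x t k.succ * y t i
        = 2 * (if κ t = k then x t 0 * y t i else 0) := fun t => by
      rw [hκ t k]; split_ifs <;> ring
    simp only [this, ← Finset.mul_sum] at h
    rw [Finset.sum_filter]
    linarith
  have hxyv : ∀ i t, x t 0 * y t i = 1 ∨ x t 0 * y t i = -1 := fun i t => by
    rcases hx t 0 with h | h <;> rcases hy t i with h' | h' <;> simp [h, h']
  have heven : ∀ k, Even (Finset.univ.filter fun t => κ t = k).card := fun k =>
    even_card_of_sum_eq_zero (hxyv 0) (hblock k 0)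
  have hbound : ∀ k, 0 < (Finset.univ.filter fun t => κ t = k).card ∧
      (Finset.univ.filter fun t => κ t = k).card ≤ 4 := fun k => by
    have h1 := hgx 0 k.succ (Fin.succ_ne_zero k).symm
    have h2 := hcard k
    omega
  obtain ⟨k₀, hk₀⟩ : ∃ k₀, ∀ k, (Finset.univ.filter fun t => κ t = k).card =
      if k = k₀ then 4 else 2 :=
    exists_eq_four_of_sum_eq_eight hsumcard heven hbound
  obtain ⟨σ, τ, hστ⟩ := exists_equiv_standardBlock hk₀
  have hsumσ : ∀ k i, ∑ t with standardBlock t = k, x (σ t) 0 * y (σ t) i = 0 := by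
    intro k i
    rw [← hblock (τ k) i, Finset.sum_filter, Finset.sum_filter,
      ← Equiv.sum_comp σ fun t => if κ t = τ k then x t 0 * y t i else 0]
    simp only [hστ, EmbeddingLike.apply_eq_iff_eq]
  have hb := fun i => sum_filter_standardBlock fun t => x (σ t) 0 * y (σ t) i
  -- Multiplying the rows of `y` by the signs of column 0 of `x` keeps the inner products and zero
  -- row sums and makes `y` balanced on the blocks.
  refine not_forall_gram_of_blocks (z := fun t i => x (σ t) 0 * y (σ t) i)
    (fun t i => hxyv i (σ t)) (fun t => by rw [← Finset.mul_sum, hys, mul_zero])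
    (fun i => by rw [← (hb i).1, hsumσ]) (fun i => by rw [← (hb i).2.1, hsumσ])
    (fun i => by rw [← (hb i).2.2, hsumσ]) fun i j hij => ?_
  have : gram (fun t i => x (σ t) 0 * y (σ t) i) i j = gram y i j := by
    simp only [gram]
    rw [← Equiv.sum_comp σ fun t => y t i * y t j]
    refine Finset.sum_congr rfl fun t _ => ?_
    rcases hx (σ t) 0 with h | h <;> rw [h] <;> ring
  rw [this]
  exact hgy i j hij

/-! ### Inner products between -6 and 0 -/

/-- Ten columns of length eight with entries `±1` and zero row sums cannot have all their mutual
inner products nonpositive and greater than `-8`. -/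
theorem not_forall_gram_mem_Ioc {v : Fin 8 → Fin 10 → ℤ} (hv : ∀ t i, v t i = 1 ∨ v t i = -1)
    (hs : ∀ t, ∑ i, v t i = 0) (hg : ∀ i j, i ≠ j → gram v i j ≤ 0 ∧ -8 < gram v i j) : False := by
  obtain ⟨w, hw0, hws, hw⟩ := exists_relation_sum_zero v
  obtain ⟨m, -, hm⟩ := Finset.exists_max_image Finset.univ w ⟨0, Finset.mem_univ _⟩
  let S : Finset (Fin 10) := Finset.univ.filter fun i => w i = w m
  have hS : ∀ i, i ∈ S ↔ w i = w m := fun i => by simp [S]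
  have horth : ∀ i ∈ S, ∀ j ∉ S, gram v i j = 0 := by
    intro i hi j hj
    rw [hS] at hi hj
    -- Shifting `w` by its maximum keeps it in the kernel of the Gram matrix and makes every term
    -- nonnegative; the positive diagonal entry meets the factor 0.
    have hsum : ∑ l, (gram v i l : ℚ) * (w l - w m) = 0 := by
      simp only [mul_sub, Finset.sum_sub_distrib, sum_gram_mul_relation hw, ← Finset.sum_mul]
      have := sum_gram (s := Finset.univ) hs i
      rw [← Int.cast_sum, this]
      simp
    have hnn : ∀ l ∈ Finset.univ, 0 ≤ (gram v i l : ℚ) * (w l - w m) := fun l _ => by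
      by_cases hl : i = l
      · subst hl; simp [hi]
      · exact mul_nonneg_of_nonpos_of_nonpos (by exact_mod_cast (hg i l hl).1)
          (sub_nonpos.2 (hm l (Finset.mem_univ _)))
    have := (Finset.sum_eq_zero_iff_of_nonneg hnn).1 hsum j (Finset.mem_univ _)
    rcases mul_eq_zero.1 this with h | h
    · exact_mod_cast h
    · exact absurd (sub_eq_zero.1 h) hj
  have hSsum : ∀ t, ∑ i ∈ S, v t i = 0 := by
    -- By orthogonality to the complement, the rows of the Gram matrix restricted to `S` already sum
    -- to zero.
    have hsq : ∑ t, (∑ i ∈ S, v t i) ^ 2 = 0 := by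
      have : ∀ t, (∑ i ∈ S, v t i) ^ 2 = ∑ i ∈ S, ∑ j ∈ S, v t i * v t j := fun t => by
        rw [sq, Finset.sum_mul_sum]
      simp only [this]
      rw [Finset.sum_comm]
      refine Finset.sum_eq_zero fun i hi => ?_
      rw [Finset.sum_comm]
      have h := sum_gram (s := Finset.univ) hs i
      rw [← Finset.sum_add_sum_compl S,
        Finset.sum_eq_zero (s := Sᶜ) fun j hj => horth i hi j (Finset.mem_compl.1 hj),
        add_zero] at h
      exact h
    intro t
    have := (Finset.sum_eq_zero_iff_of_nonneg fun t _ => sq_nonneg _).1 hsq t (Finset.mem_univ _)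
    exact pow_eq_zero_iff (two_ne_zero) |>.1 this
  have hScsum : ∀ t, ∑ i ∈ Sᶜ, v t i = 0 := fun t => by
    have h := hs t
    rw [← Finset.sum_add_sum_compl S, hSsum, zero_add] at h
    exact h
  have hmS : m ∈ S := (hS m).2 rfl
  -- Otherwise `w` would be constant with sum zero.
  have hne : Sᶜ.Nonempty := by
    rw [Finset.nonempty_iff_ne_empty]
    intro h
    have hall : ∀ i, w i = w m := fun i => (hS i).1 (by
      by_contra hi
      have := Finset.mem_compl.2 hi
      rw [h] at this
      exact absurd this (Finset.notMem_empty i))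
    simp only [hall, Finset.sum_const, Finset.card_univ, Fintype.card_fin, nsmul_eq_mul] at hws
    have hm0 : w m = 0 := by
      push_cast at hws
      linarith
    exact hw0 (funext fun i => by rw [hall i, hm0]; rfl)
  -- Two columns with zero row sums are opposite, with the excluded inner product -8.
  have htwo : ∀ U : Finset (Fin 10), (∀ t, ∑ i ∈ U, v t i = 0) → U.card ≠ 2 := by
    intro U hU h2
    obtain ⟨a, b, hab, rfl⟩ := Finset.card_eq_two.1 h2
    have h := sum_gram hU a
    rw [Finset.sum_pair hab, gram_self hv] at h
    have := (hg a b hab).2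
    omega
  have hfour : ∀ U : Finset (Fin 10), (∀ t, ∑ i ∈ U, v t i = 0) → (∀ t, ∑ i ∈ Uᶜ, v t i = 0) →
      (∀ i ∈ U, ∀ j ∉ U, gram v i j = 0) → U.card ≠ 4 := by
    intro U hU hUc hUo h4
    have h6 : Uᶜ.card = 6 := by simp [Finset.card_compl, h4]
    have hsumemb : ∀ {n : ℕ} (W : Finset (Fin 10)) (hW : W.card = n) (t : Fin 8),
        ∑ i, v t (W.orderEmbOfFin hW i) = ∑ i ∈ W, v t i := fun {n} W hW t => by
      conv_rhs => rw [← Finset.map_orderEmbOfFin_univ W hW]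
      rw [Finset.sum_map]
      rfl
    exact not_forall_gram_of_four_six (x := fun t i => v t (U.orderEmbOfFin h4 i))
      (y := fun t i => v t (Uᶜ.orderEmbOfFin h6 i)) (fun t i => hv t _) (fun t i => hv t _)
      (fun t => (hsumemb U h4 t).trans (hU t)) (fun t => (hsumemb _ h6 t).trans (hUc t))
      (fun i j => hUo _ (Finset.orderEmbOfFin_mem U h4 i) _
        (Finset.mem_compl.1 (Finset.orderEmbOfFin_mem _ h6 j)))
      (fun i j hij => hg _ _ fun h => hij ((U.orderEmbOfFin h4).injective h))
      (fun i j hij => hg _ _ fun h => hij ((Uᶜ.orderEmbOfFin h6).injective h))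
  have heven := even_card_of_sum_eq_zero (hv 0) (hSsum 0)
  have hcardc : Sᶜ.card = 10 - S.card := by simp [Finset.card_compl]
  have hp1 := Finset.card_pos.2 ⟨m, hmS⟩
  have hp2 := Finset.card_pos.2 hne
  have h2 := htwo S hSsum
  have h3 := htwo Sᶜ hScsum
  have h4 := hfour S hSsum hScsum horth
  have h5 := hfour Sᶜ hScsum (by simpa using hSsum) fun i hi j hj => by
    rw [gram_comm]
    exact horth j (by simpa using hj) i (Finset.mem_compl.1 hi)
  rw [Nat.even_iff] at heven
  omega

/-! ### From pairing lists to sign matrices -/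

namespace PairingList

section

variable {T : Type*} [Fintype T] [DecidableEq T]

theorem pairings_eq_sum {n k : ℕ} (P : PairingList T n k) (t t' : T) :
    P.pairings t t' = ∑ i, if (P.flight i).part t = (P.flight i).part t' then 1 else 0 := by
  refine Finset.sum_congr rfl fun i _ => ?_
  have hmem := fun a => (P.flight i).mem_part_self.2 (Finset.mem_univ a)
  have hpart := fun a => (P.flight i).part_mem.2 (Finset.mem_univ a)
  split_ifs with h
  · rw [Finset.card_eq_one]
    refine ⟨(P.flight i).part t, ?_⟩
    ext r
    rw [Finset.mem_filter, Finset.mem_singleton]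
    constructor
    · rintro ⟨hr, ht, -⟩
      exact ((P.flight i).part_eq_of_mem hr ht).symm
    · rintro rfl
      exact ⟨hpart t, hmem t, h ▸ hmem t'⟩
  · rw [Finset.card_eq_zero, Finset.filter_eq_empty_iff]
    rintro r hr ⟨ht, ht'⟩
    exact h (((P.flight i).part_eq_of_mem hr ht).trans ((P.flight i).part_eq_of_mem hr ht').symm)

/-- The sign of the team `t` in the flight `i`: whether it races against the team `t₀`. -/
def sign {n k : ℕ} (P : PairingList T n k) (t₀ : T) (i : Fin n) (t : T) : ℤ :=
  if (P.flight i).part t = (P.flight i).part t₀ then 1 else -1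

theorem sign_eq_one_or {n k : ℕ} (P : PairingList T n k) (t₀ : T) (i : Fin n) (t : T) :
    P.sign t₀ i t = 1 ∨ P.sign t₀ i t = -1 := by
  rw [sign]; split_ifs <;> simp

theorem sum_sign {n : ℕ} (hT : Fintype.card T = 10) (P : PairingList T n 5) (t₀ : T) (i : Fin n) :
    ∑ t, P.sign t₀ i t = 0 := by
  have hfilter : (Finset.univ.filter fun t => (P.flight i).part t = (P.flight i).part t₀) =
      (P.flight i).part t₀ := by
    ext t
    rw [Finset.mem_filter, (P.flight i).part_eq_iff_mem ((P.flight i).part_mem.2 (by simp))]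
    simp
  have hcard := P.card_race i _ ((P.flight i).part_mem.2 (Finset.mem_univ t₀))
  have h : ∀ t, P.sign t₀ i t =
      2 * (if (P.flight i).part t = (P.flight i).part t₀ then 1 else 0) - 1 := fun t => by
    rw [sign]; split_ifs <;> norm_num
  simp only [h, Finset.sum_sub_distrib, ← Finset.mul_sum, Finset.sum_boole, hfilter, hcard]
  simp [hT]

theorem card_parts_eq_two {n : ℕ} (hT : Fintype.card T = 10) (P : PairingList T n 5) (i : Fin n) :
    (P.flight i).parts.card = 2 := by
  have h := (P.flight i).sum_card_parts
  rw [Finset.sum_congr rfl (P.card_race i), Finset.sum_const, smul_eq_mul, Finset.card_univ,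
    hT] at h
  omega

/-- A flight has only two races, so two teams have equal signs exactly when they race together; the
reference team `t₀` cancels. -/
theorem sum_sign_mul_sign {n : ℕ} (hT : Fintype.card T = 10) (P : PairingList T n 5)
    (t₀ t t' : T) : ∑ i, P.sign t₀ i t * P.sign t₀ i t' = 2 * P.pairings t t' - n := by
  have h : ∀ i, P.sign t₀ i t * P.sign t₀ i t' =
      2 * (if (P.flight i).part t = (P.flight i).part t' then 1 else 0) - 1 := by
    intro i
    obtain ⟨p, q, hpq, hparts⟩ := Finset.card_eq_two.1 (P.card_parts_eq_two hT i)
    have hpart : ∀ a, (P.flight i).part a = p ∨ (P.flight i).part a = q := fun a => by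
      have := (P.flight i).part_mem.2 (Finset.mem_univ a)
      simpa [hparts] using this
    rw [sign, sign]
    rcases hpart t with h1 | h1 <;> rcases hpart t' with h2 | h2 <;>
      rcases hpart t₀ with h3 | h3 <;> simp [h1, h2, h3, hpq, hpq.symm]
  simp only [h, pairings_eq_sum, Finset.sum_sub_distrib, ← Finset.mul_sum]
  simp

/-- Pairing lists with ten teams, eight flights, races of five teams and a utility value of at most
three. -/
theorem lambda_eq_of_utility_le_three (team : Fin 10 ≃ T) (P : PairingList T 8 5)
    (hP : P.utility ≤ 3) : P.lambdaMin = 2 ∧ P.lambdaMax = 5 := by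
  have hT : Fintype.card T = 10 := by rw [← Fintype.card_congr team, Fintype.card_fin]
  have : Nontrivial T := team.symm.nontrivial
  let v : Fin 8 → Fin 10 → ℤ := fun i j => P.sign (team 0) i (team j)
  have hv : ∀ i j, v i j = 1 ∨ v i j = -1 := fun i j => P.sign_eq_one_or _ _ _
  have hs : ∀ i, ∑ j, v i j = 0 := fun i =>
    (Equiv.sum_comp team fun t => P.sign (team 0) i t).trans (P.sum_sign hT _ i)
  have hgram : ∀ i j, gram v i j = 2 * P.pairings (team i) (team j) - 8 := fun i j =>
    P.sum_sign_mul_sign hT _ _ _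
  have hmin : ∀ i j, i ≠ j → 2 * (P.lambdaMin : ℤ) - 8 ≤ gram v i j := fun i j hij => by
    have := P.isLeast_lambdaMin.2 ⟨team i, team j, team.injective.ne hij, rfl⟩
    rw [hgram]
    omega
  have hmax : ∀ i j, i ≠ j → gram v i j ≤ 2 * (P.lambdaMax : ℤ) - 8 := fun i j hij => by
    have := P.isGreatest_lambdaMax.2 ⟨team i, team j, team.injective.ne hij, rfl⟩
    rw [hgram]
    omega
  have hsum : ∑ j ∈ Finset.univ.erase 0, gram v 0 j = -8 := by
    have h := sum_gram (s := Finset.univ) hs 0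
    rw [← Finset.add_sum_erase _ _ (Finset.mem_univ 0), gram_self hv] at h
    linarith
  -- Each team has 32 meetings with nine opponents, and `3 < 32 / 9 < 4`.
  have hmin3 : P.lambdaMin ≤ 3 := by
    have h := Finset.card_nsmul_le_sum (Finset.univ.erase 0) (gram v 0) _ fun j hj =>
      hmin 0 j (Finset.ne_of_mem_erase hj).symm
    rw [hsum] at h
    simp at h
    omega
  have hmax4 : 4 ≤ P.lambdaMax := by
    have h := Finset.sum_le_card_nsmul (Finset.univ.erase 0) (gram v 0) _ fun j hj =>
      hmax 0 j (Finset.ne_of_mem_erase hj).symm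
    rw [hsum] at h
    simp at h
    omega
  have hA : ¬(1 ≤ P.lambdaMin ∧ P.lambdaMax ≤ 4) := fun h =>
    not_forall_gram_mem_Ioc hv hs fun i j hij => by
      have := hmin i j hij
      have := hmax i j hij
      omega
  have hB : ¬(3 ≤ P.lambdaMin ∧ P.lambdaMax ≤ 6) := fun h =>
    not_forall_gram_mem_Icc hv hs
      (fun i j hij => by have := hmin i j hij; omega)
      (fun i j hij => by have := hmax i j hij; omega)
  rw [utility] at hP
  omega

/-! ### Realizing a tournament plan -/

instance decidableRelKer (f : T → ℕ) : DecidableRel (Setoid.ker f) := fun a b =>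
  inferInstanceAs (Decidable (f a = f b))

/-- The pairing list whose flights are the partitions into the fibres of the given functions. -/
def ofFibers {n k : ℕ} (f : Fin n → T → ℕ)
    (h : ∀ i t, (Finset.univ.filter fun t' => f i t' = f i t).card = k) : PairingList T n k :=
  { flight := fun i => Finpartition.ofSetoid (Setoid.ker (f i))
    card_race := fun i r hr => by
      obtain ⟨t, ht⟩ := Finpartition.nonempty_of_mem_parts _ hr
      rw [← h i t]
      congr 1
      ext t'
      rw [← Finpartition.part_eq_of_mem _ hr ht, Finpartition.mem_part_ofSetoid_iff_rel,
        Finset.mem_filter]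
      exact ⟨fun h => ⟨Finset.mem_univ _, h.symm⟩, fun h => h.2.symm⟩ }

theorem mem_part_ofFibers {n k : ℕ} {f : Fin n → T → ℕ}
    {h : ∀ i t, (Finset.univ.filter fun t' => f i t' = f i t).card = k} {i : Fin n} {t t' : T} :
    t' ∈ ((ofFibers f h).flight i).part t ↔ f i t = f i t' :=
  Finpartition.mem_part_ofSetoid_iff_rel

theorem part_ofFibers_eq_iff {n k : ℕ} {f : Fin n → T → ℕ}
    {h : ∀ i t, (Finset.univ.filter fun t' => f i t' = f i t).card = k} {i : Fin n} {t t' : T} :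
    ((ofFibers f h).flight i).part t = ((ofFibers f h).flight i).part t' ↔ f i t = f i t' := by
  rw [← Finpartition.mem_part_iff_part_eq_part _ (Finset.mem_univ _) (Finset.mem_univ _),
    mem_part_ofFibers, eq_comm]

theorem pairings_ofFibers {n k : ℕ} {f : Fin n → T → ℕ}
    {h : ∀ i t, (Finset.univ.filter fun t' => f i t' = f i t).card = k} (t t' : T) :
    (ofFibers f h).pairings t t' = (Finset.univ.filter fun i => f i t = f i t').card := by
  simp only [pairings_eq_sum, part_ofFibers_eq_iff, Finset.sum_boole, Nat.cast_id]

theorem hasTournamentPlan_ofFibers {n k : ℕ} {f : Fin n → T → ℕ}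
    {h : ∀ i t, (Finset.univ.filter fun t' => f i t' = f i t).card = k}
    (hf : ∀ i, Set.range (f i) = Set.Icc 1 (Fintype.card T / k)) :
    (ofFibers f h).HasTournamentPlan (Matrix.of f) := by
  intro i
  -- The function `f i` is constant on a race, so its supremum there serves as the race number.
  have hnum : ∀ t, (((ofFibers f h).flight i).part t).sup (f i) = f i t := fun t => by
    apply le_antisymm
    · exact Finset.sup_le fun t' ht' => (mem_part_ofFibers.1 ht').ge
    · exact Finset.le_sup (f := f i) (mem_part_ofFibers.2 rfl)
  have hex : ∀ r ∈ ((ofFibers f h).flight i).parts,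
      ∃ t, ((ofFibers f h).flight i).part t = r := fun r hr => by
    obtain ⟨t, ht⟩ := Finpartition.nonempty_of_mem_parts _ hr
    exact ⟨t, Finpartition.part_eq_of_mem _ hr ht⟩
  refine ⟨fun r => r.sup (f i), ⟨?_, ?_, ?_⟩, fun t => (hnum t).symm⟩
  · intro r hr
    obtain ⟨t, rfl⟩ := hex r hr
    simp only [hnum, ← hf i]
    exact Set.mem_range_self t
  · intro r hr r' hr' hrr'
    obtain ⟨t, rfl⟩ := hex r hr
    obtain ⟨t', rfl⟩ := hex r' hr'
    simp only [hnum] at hrr'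
    exact part_ofFibers_eq_iff.2 hrr'
  · intro m hm
    rw [← hf i] at hm
    obtain ⟨t, rfl⟩ := hm
    exact ⟨_, Finpartition.part_mem _ |>.2 (Finset.mem_univ t), hnum t⟩

end

end PairingList

theorem exists_hasTournamentPlan_planTenTeamsEightFlights {T : Type*} [Fintype T] [DecidableEq T]
    (team : Fin 10 ≃ T) : ∃ P : PairingList T 8 5,
      P.HasTournamentPlan (planTenTeamsEightFlights.submatrix id team.symm) ∧ P.utility ≤ 3 := by
  have hT : Fintype.card T = 10 := by rw [← Fintype.card_congr team, Fintype.card_fin]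
  have : Nontrivial T := team.symm.nontrivial
  have hcard : ∀ i j, (Finset.univ.filter fun j' =>
      planTenTeamsEightFlights i j' = planTenTeamsEightFlights i j).card = 5 := by decide
  have hvalues : ∀ i, Finset.univ.image (planTenTeamsEightFlights i) = Finset.Icc 1 2 := by decide
  have hpairs : ∀ j j', j ≠ j' → 2 ≤ (Finset.univ.filter fun i =>
        planTenTeamsEightFlights i j = planTenTeamsEightFlights i j').card ∧
      (Finset.univ.filter fun i =>
        planTenTeamsEightFlights i j = planTenTeamsEightFlights i j').card ≤ 5 := by decide
  have h : ∀ i t, (Finset.univ.filter fun t' => planTenTeamsEightFlights i (team.symm t') =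
      planTenTeamsEightFlights i (team.symm t)).card = 5 := fun i t => by
    rw [← hcard i (team.symm t), ← Finset.card_map team.symm.toEmbedding]
    congr 1
    ext j
    simp
  let P : PairingList T 8 5 :=
    PairingList.ofFibers (fun i t => planTenTeamsEightFlights i (team.symm t)) h
  refine ⟨P, PairingList.hasTournamentPlan_ofFibers fun i => ?_, ?_⟩
  · rw [hT, ← Finset.coe_Icc, ← hvalues i, Finset.coe_image, Finset.coe_univ, Set.image_univ]
    exact team.symm.surjective.range_comp (planTenTeamsEightFlights i)
  · obtain ⟨t, t', hne, hmin⟩ := P.isLeast_lambdaMin.1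
    obtain ⟨u, u', hne', hmax⟩ := P.isGreatest_lambdaMax.1
    rw [PairingList.pairings_ofFibers] at hmin hmax
    have h1 := (hpairs _ _ (team.symm.injective.ne hne)).1
    have h2 := (hpairs _ _ (team.symm.injective.ne hne')).2
    rw [PairingList.utility]
    omega

/-- `T` is any set of ten teams, numbered by `team`; the pairing lists have eight flights and races
of five teams. -/
theorem mainTheorem1 {T : Type*} [Fintype T] [DecidableEq T] (team : Fin 10 ≃ T) :
    IsLeast (Set.range fun P : PairingList T 8 5 => P.utility) 3 ∧
    (∀ P : PairingList T 8 5, P.IsOptimal →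
      P.utility = 3 ∧ P.lambdaMin = 2 ∧ P.lambdaMax = 5) ∧
    ∃ P : PairingList T 8 5,
      P.HasTournamentPlan (planTenTeamsEightFlights.submatrix id team.symm) ∧ P.IsOptimal := by
  have heq : ∀ P : PairingList T 8 5, P.utility ≤ 3 → P.utility = 3 := fun P hP => by
    obtain ⟨h1, h2⟩ := P.lambda_eq_of_utility_le_three team hP
    rw [PairingList.utility, h1, h2]
    norm_num
  have hge : ∀ P : PairingList T 8 5, 3 ≤ P.utility := fun P => by
    by_contra hlt
    have := heq P (by omega)
    omega
  obtain ⟨P, hplan, hP⟩ := exists_hasTournamentPlan_planTenTeamsEightFlights team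
  refine ⟨⟨⟨P, heq P hP⟩, ?_⟩, fun Q hQ => ?_, P, hplan, fun Q => hP.trans (hge Q)⟩
  · rintro _ ⟨Q, rfl⟩
    exact hge Q
  · have hQ3 := (hQ P).trans hP
    exact ⟨heq Q hQ3, Q.lambda_eq_of_utility_le_three team hQ3⟩
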